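/- Let $M_P>T_P\ge 1$ and $L,K\ge 1$ be integers, let $\Phi=M_P-T_P$, $Q_1=\lfloor (T_P-1)/\Phi\rfloor$, $J=T_P-1-Q_1\Phi$ and $Q_2=\lceil \Phi/J\rceil$, and assume $Q_1\ge 1$ (if $J=0$, the block with $J$ columns below is absent and $1/Q_2$ is read as $0$). Put $M=M_PL$, $T=T_PL$, and let $A=\widetilde A\otimes I_L\in\mathbb C^{M\times T}$, where $$\widetilde A=\begin{bmatrix} I_{T_P}\\ \widetilde A_B\end{bmatrix},\qquad \widetilde A_B=\Big[\,\mathbf 1_{\Phi\times 1}\;\;\; [\mathbf 1_{Q_2\times 1}\otimes I_J]_{1:\Phi,:}\;\;\; \underbrace{I_\Phi\;\cdots\; I_\Phi}_{Q_1}\,\Big]\in\mathbb C^{\Phi\times T_P},$$ and $[\,\cdot\,]_{1:\Phi,:}$ denotes the first $\Phi$ rows. A WAX decomposition of $H\in\mathbb C^{M\times K}$ is a factorization $H=WAX$ with $W=\mathrm{diag}(W_1,\dots,W_{M_P})$ block diagonal, $W_m\in\mathbb C^{L\times L}$, and $X\in\mathbb C^{T\times K}$. Call a random matrix $H\in\mathbb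 C^{M\times K}$ randomly chosen if it is in general position, i.e. every nonzero complex polynomial in its $MK$ entries is nonzero with probability $1$ (for instance, if its entries are IID Gaussian, or if its law is absolutely continuous with respect to Lebesgue measure); in particular every submatrix of $H$ then has full rank with probability $1$. If $$L\ \ge\ \frac{K}{1+Q_1+\frac1{Q_2}},$$ then a randomly chosen $H\in\mathbb C^{M\times K}$ admits a WAX decomposition for the given $A$ with probability $1$. Moreover, $W_1$ can be fixed to an arbitrary full-rank matrix: with probability $1$, for every invertible $W_1\in\mathbb C^{L\times L}$ there is a WAX decomposition of $H$ whose first diagonal block is $W_1$. -/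

import Mathlib

open MeasureTheory
open scoped Kronecker

namespace WAX

/-- `Φ = M_P - T_P`. -/
def Phi (MP TP : ℕ) : ℕ := MP - TP

/-- `Q₁ = ⌊(T_P - 1) / Φ⌋`. -/
def Q1 (MP TP : ℕ) : ℕ := (TP - 1) / Phi MP TP

/-- `J = T_P - 1 - Q₁ Φ`. -/
def J (MP TP : ℕ) : ℕ := TP - 1 - Q1 MP TP * Phi MP TP

/-- `Q₂ = ⌈Φ / J⌉` (used only for `J ≥ 1`). -/
noncomputable def Q2 (MP TP : ℕ) : ℕ := ⌈(Phi MP TP : ℝ) / (J MP TP : ℝ)⌉₊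

/-- `1 / Q₂`, where for `J = 0` one reads `Q₂ = ∞`, that is `1 / Q₂ = 0`. -/
noncomputable def invQ2 (MP TP : ℕ) : ℝ :=
  if J MP TP = 0 then 0 else 1 / (Q2 MP TP : ℝ)

/-- The `T_P = 1 + J + Q₁ Φ` columns, in the order of the blocks of the bottom part:
the first column, the next `J` columns, and then `Q₁` groups of `Φ` columns. -/
abbrev Col (MP TP : ℕ) : Type :=
  Unit ⊕ Fin (J MP TP) ⊕ (Fin (Q1 MP TP) × Fin (Phi MP TP))

/-- The `M_P = T_P + Φ` panels (rows): `T_P` top rows followed by `Φ` bottom rows. -/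
abbrev Panel (MP TP : ℕ) : Type := Col MP TP ⊕ Fin (Phi MP TP)

/-- The number of columns is `T_P`. -/
theorem card_col {MP TP : ℕ} (h : 1 ≤ Q1 MP TP) : Fintype.card (Col MP TP) = TP := by
  have h1 : Q1 MP TP * Phi MP TP ≤ TP - 1 := Nat.div_mul_le_self _ _
  have h2 : TP - 1 ≠ 0 := by
    intro h0
    simp [Q1, h0] at h
  have h3 : J MP TP = TP - 1 - Q1 MP TP * Phi MP TP := rfl
  simp only [Col, Fintype.card_sum, Fintype.card_prod, Fintype.card_fin, Fintype.card_unit]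
  omega

/-- The number of panels is `M_P`. -/
theorem card_panel {MP TP : ℕ} (h : 1 ≤ Q1 MP TP) : Fintype.card (Panel MP TP) = MP := by
  have h1 : Phi MP TP ≠ 0 := by
    intro h0
    simp [Q1, h0] at h
  have h2 := card_col h
  simp only [Panel, Fintype.card_sum, Fintype.card_fin] at h2 ⊢
  simp only [Phi] at h1 h2 ⊢
  omega

/-- The cropped block `[1_{Q₂ × 1} ⊗ I_J]_{1:Φ,:}`: `I_J` is repeated vertically and cut after
`Φ` rows, so its row `r` (counted from `0`) is row `r mod J` of `I_J`. -/
def cropped (MP TP : ℕ) : Matrix (Fin (Phi MP TP)) (Fin (J MP TP)) ℂ :=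
  Matrix.of fun r j => if (r : ℕ) % J MP TP = (j : ℕ) then 1 else 0

/-- `Ã_B = [1_{Φ × 1}, [1_{Q₂ × 1} ⊗ I_J]_{1:Φ,:}, I_Φ, …, I_Φ]` with `Q₁` blocks `I_Φ`. -/
def AtildeB (MP TP : ℕ) : Matrix (Fin (Phi MP TP)) (Col MP TP) ℂ :=
  Matrix.fromCols (Matrix.of fun _ _ => 1)
    (Matrix.fromCols (cropped MP TP)
      (Matrix.of fun r c => (1 : Matrix (Fin (Phi MP TP)) (Fin (Phi MP TP)) ℂ) r c.2))

/-- `Ã`, with top part `Ã_T = I_{T_P}` and bottom part `Ã_B`. -/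
def Atilde (MP TP : ℕ) : Matrix (Panel MP TP) (Col MP TP) ℂ :=
  Matrix.fromRows 1 (AtildeB MP TP)

/-- `A = Ã ⊗ I_L`, an `M × T` matrix with `M = M_P L` and `T = T_P L`. -/
def A (MP TP L : ℕ) : Matrix (Panel MP TP × Fin L) (Col MP TP × Fin L) ℂ :=
  Atilde MP TP ⊗ₖ (1 : Matrix (Fin L) (Fin L) ℂ)

/-- The first panel. -/
def firstPanel (MP TP : ℕ) : Panel MP TP := Sum.inl (Sum.inl ())

/-- `diag(W_1, …, W_{M_P})`, with rows and columns indexed by (panel, index within the panel). -/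
def diagW {p : Type*} [DecidableEq p] {L : ℕ} (W : p → Matrix (Fin L) (Fin L) ℂ) :
    Matrix (p × Fin L) (p × Fin L) ℂ :=
  (Matrix.blockDiagonal W).submatrix Prod.swap Prod.swap

/-- `H = W A X` with block diagonal `W = diag(W_1, …, W_{M_P})` and arbitrary `X`. -/
def IsWAX {p t k : Type*} [Fintype p] [DecidableEq p] [Fintype t] {L : ℕ}
    (A : Matrix (p × Fin L) (t × Fin L) ℂ) (H : Matrix (p × Fin L) k ℂ)
    (W : p → Matrix (Fin L) (Fin L) ℂ) (X : Matrix (t × Fin L) k ℂ) : Prop :=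
  H = diagW W * A * X

/-- `H` admits a WAX decomposition for the combining matrix `A`. -/
def AdmitsWAX {p t k : Type*} [Fintype p] [DecidableEq p] [Fintype t] {L : ℕ}
    (A : Matrix (p × Fin L) (t × Fin L) ℂ) (H : Matrix (p × Fin L) k ℂ) : Prop :=
  ∃ W X, IsWAX A H W X

/-- A randomly chosen matrix: a random complex matrix in general position, i.e. every nonzero
polynomial in the entries is nonzero with probability 1. Applied to the minors this says that every
submatrix has full rank with probability 1; a matrix with IID Gaussian entries is an example, and so
is every matrix whose law is absolutely continuous with respect to Lebesgue measure. -/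
def RandomlyChosen {Ω : Type*} [MeasurableSpace Ω] (P : Measure Ω) {m k : Type*}
    (H : Ω → Matrix m k ℂ) : Prop :=
  (∀ i j, Measurable fun ω => H ω i j) ∧
    ∀ f : MvPolynomial (m × k) ℂ, f ≠ 0 →
      ∀ᵐ ω ∂P, MvPolynomial.eval (fun ij => H ω ij.1 ij.2) f ≠ 0

end WAX

namespace WAX

/-! With `V_p = W_p⁻¹`, the top rows of `A` force `X_c = V_c H_c`. What remains are the equations
`V_r H_r = ∑ c, (A_B)_{rc} V_c H_c`, linear in the row `U` of blocks `V_p`: `U * S(H) = 0`, with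
`S(H)` the constraint matrix. One needs a solution with all blocks invertible. If `H₀ = A X`, all
`V_p = I` is a solution. If moreover `S(H₀)` has independent columns, this solution extends to one
that is polynomial in `H` (`exists_poly_annihilator`); its block determinants do not vanish at `H₀`,
hence not for generic `H`. So a single good `H₀` suffices (`exists_injective_witness`). It is built
from coordinate projections, and the bound on `L` is what lets them separate all coordinates. -/

open Matrix in
/-- If the columns of the polynomial matrix `S` are linearly independent at a point `h₀`, then a left
annihilator of `S h₀` with invertible blocks persists for generic `h`. -/
theorem exists_poly_annihilator {σ ε p : Type*} [Fintype p] [DecidableEq p] [Fintype ε]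
    [DecidableEq ε] {L : ℕ} (S : Matrix (p × Fin L) ε (MvPolynomial σ ℂ)) (h₀ : σ → ℂ)
    (hinj : ∀ x : ε → ℂ, (S.map (MvPolynomial.eval h₀)) *ᵥ x = 0 → x = 0)
    (U₀ : Matrix (Fin L) (p × Fin L) ℂ) (hU : U₀ * S.map (MvPolynomial.eval h₀) = 0)
    (hdet : ∀ i, (U₀.submatrix id (Prod.mk i)).det ≠ 0) :
    ∃ f : MvPolynomial σ ℂ, f ≠ 0 ∧ ∀ h, MvPolynomial.eval h f ≠ 0 →
      ∃ U : Matrix (Fin L) (p × Fin L) ℂ, U * S.map (MvPolynomial.eval h) = 0 ∧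
        ∀ i, (U.submatrix id (Prod.mk i)).det ≠ 0 := by
  obtain ⟨T, hT⟩ : ∃ T : Matrix ε (p × Fin L) ℂ, T * S.map (MvPolynomial.eval h₀) = 1 := by
    obtain ⟨g, hg⟩ := LinearMap.exists_leftInverse_of_injective
      (Matrix.toLin' (S.map (MvPolynomial.eval h₀))) (by
        rw [LinearMap.ker_eq_bot']
        intro x hx
        exact hinj x (by simpa using hx))
    refine ⟨LinearMap.toMatrix' g, ?_⟩
    have := congrArg LinearMap.toMatrix' hg
    rwa [LinearMap.toMatrix'_comp, LinearMap.toMatrix'_toLin', LinearMap.toMatrix'_id] at this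
  let C : ℂ →+* MvPolynomial σ ℂ := MvPolynomial.C
  let B : Matrix ε ε (MvPolynomial σ ℂ) := T.map C * S
  -- Correct `U₀` by `U₀ S (T S)⁻¹ T`, with `det (T S)` cleared to stay polynomial. The correction
  -- vanishes at `h₀`, where `U₀ S = 0` and `T S = 1`.
  let N : Matrix (Fin L) (p × Fin L) (MvPolynomial σ ℂ) :=
    B.det • U₀.map C - U₀.map C * S * B.adjugate * T.map C
  have hNS : N * S = 0 := by
    have h1 : U₀.map C * S * B.adjugate * T.map C * S = U₀.map C * S * (B.adjugate * B) := by
      simp only [B, Matrix.mul_assoc]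
    simp only [N, Matrix.sub_mul, h1, Matrix.adjugate_mul, Matrix.smul_mul, Matrix.mul_smul,
      Matrix.mul_one, sub_self]
  have hC : ∀ {m n : Type _} (Q : Matrix m n ℂ) (h : σ → ℂ),
      (Q.map C).map (MvPolynomial.eval h) = Q := by
    intro m n Q h
    ext i j
    simp [C]
  have hC' : ∀ (Q : Matrix (Fin L) (p × Fin L) ℂ) (h : σ → ℂ),
      (Q.map C).map (MvPolynomial.eval h) = Q := by
    intro Q h
    ext i j
    simp [C]
  have hB₀ : B.map (MvPolynomial.eval h₀) = 1 := by
    rw [Matrix.map_mul, hC, hT]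
  have hdetB : MvPolynomial.eval h₀ B.det = 1 := by
    rw [RingHom.map_det, RingHom.mapMatrix_apply, hB₀, Matrix.det_one]
  have hN₀ : N.map (MvPolynomial.eval h₀) = U₀ := by
    have h1 : (U₀.map C * S * B.adjugate * T.map C).map (MvPolynomial.eval h₀) = 0 := by
      simp only [Matrix.map_mul, hC', hU, Matrix.zero_mul]
    ext i j
    have h2 := congrFun (congrFun h1 i) j
    simp only [Matrix.map_apply, Matrix.zero_apply] at h2
    simp only [N, Matrix.map_apply, Matrix.sub_apply, Matrix.smul_apply, smul_eq_mul, map_sub,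
      map_mul, h2, hdetB, C, MvPolynomial.eval_C]
    simp
  have hblock : ∀ (h : σ → ℂ) (i : p),
      MvPolynomial.eval h (N.submatrix id (Prod.mk i)).det =
        ((N.map (MvPolynomial.eval h)).submatrix id (Prod.mk i)).det := by
    intro h i
    rw [RingHom.map_det]
    rfl
  refine ⟨∏ i, (N.submatrix id (Prod.mk i)).det, ?_, ?_⟩
  · intro h0
    have h1 := congrArg (MvPolynomial.eval h₀) h0
    rw [map_prod, map_zero] at h1
    refine Finset.prod_ne_zero_iff.mpr (fun i _ => ?_) h1
    rw [hblock, hN₀]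
    exact hdet i
  · intro h hh
    refine ⟨N.map (MvPolynomial.eval h), ?_, fun i => ?_⟩
    · rw [← Matrix.map_mul, hNS]
      ext i j
      simp
    · rw [map_prod] at hh
      rw [← hblock]
      exact Finset.prod_ne_zero_iff.mp hh i (Finset.mem_univ i)

/-! ### Left annihilators of the constraint matrix and WAX decompositions -/

/-- The matrix whose left annihilators are the families `V_p = W_p⁻¹` with
`V_r H_r = ∑ c, (A_B)_{r c} V_c H_c` for every bottom panel `r`. -/
def constraintMatrix {R τ ρ κ : Type*} [CommRing R] [DecidableEq ρ] {L : ℕ} (AB : Matrix ρ τ R)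
    (H : Matrix ((τ ⊕ ρ) × Fin L) κ R) : Matrix ((τ ⊕ ρ) × Fin L) (ρ × κ) R :=
  Matrix.of fun pl rk => Matrix.fromCols (-AB) 1 rk.1 pl.1 * H pl rk.2

/-- The rows of `H` in the panel `i`. -/
def panel {R p κ : Type*} {L : ℕ} (H : Matrix (p × Fin L) κ R) (i : p) : Matrix (Fin L) κ R :=
  H.submatrix (Prod.mk i) id

theorem constraint_iff {τ ρ κ : Type*} [Fintype τ] [Fintype ρ] [DecidableEq ρ] {L : ℕ}
    (AB : Matrix ρ τ ℂ) (H : Matrix ((τ ⊕ ρ) × Fin L) κ ℂ)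
    (U : Matrix (Fin L) ((τ ⊕ ρ) × Fin L) ℂ) :
    U * constraintMatrix AB H = 0 ↔ ∀ r,
      U.submatrix id (Prod.mk (Sum.inr r)) * panel H (Sum.inr r) =
        ∑ c, AB r c • (U.submatrix id (Prod.mk (Sum.inl c)) * panel H (Sum.inl c)) := by
  have key : ∀ a r k, (U * constraintMatrix AB H) a (r, k) =
      (U.submatrix id (Prod.mk (Sum.inr r)) * panel H (Sum.inr r)) a k -
        (∑ c, AB r c • (U.submatrix id (Prod.mk (Sum.inl c)) * panel H (Sum.inl c))) a k := by
    intro a r k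
    simp only [Matrix.mul_apply, constraintMatrix, panel, Matrix.of_apply, Fintype.sum_prod_type,
      Fintype.sum_sum_type, Matrix.fromCols_apply_inl, Matrix.fromCols_apply_inr, Matrix.sum_apply,
      Matrix.smul_apply, Matrix.submatrix_apply, id, Matrix.neg_apply, smul_eq_mul,
      Matrix.one_apply, Finset.mul_sum]
    rw [Finset.sum_eq_single_of_mem r (Finset.mem_univ r) (by
      intro b _ hb
      simp [hb.symm]), add_comm, sub_eq_add_neg, ← Finset.sum_neg_distrib]
    congr 1
    · simp
    · refine Finset.sum_congr rfl fun c _ => ?_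
      rw [← Finset.sum_neg_distrib]
      refine Finset.sum_congr rfl fun l _ => ?_
      ring
  constructor
  · intro h r
    ext a k
    have := key a r k
    rw [h, Matrix.zero_apply] at this
    exact (sub_eq_zero.mp this.symm)
  · intro h
    ext a ⟨r, k⟩
    rw [key, h r, sub_self, Matrix.zero_apply]

theorem diagW_mul_apply {p κ : Type*} [Fintype p] [DecidableEq p] {L : ℕ}
    (W : p → Matrix (Fin L) (Fin L) ℂ) (Y : Matrix (p × Fin L) κ ℂ) (i : p) (l : Fin L) (k : κ) :
    (diagW W * Y) (i, l) k = (W i * panel Y i) l k := by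
  simp only [Matrix.mul_apply, diagW, Matrix.submatrix_apply, Fintype.sum_prod_type, panel, id,
    Prod.swap_prod_mk, Matrix.blockDiagonal_apply]
  rw [Finset.sum_eq_single_of_mem i (Finset.mem_univ i) (by
    intro b _ hb
    simp [hb.symm])]
  simp

theorem kronecker_one_mul_panel {p τ κ : Type*} [Fintype τ] {L : ℕ} (B : Matrix p τ ℂ)
    (X : Matrix (τ × Fin L) κ ℂ) (i : p) :
    panel (B ⊗ₖ (1 : Matrix (Fin L) (Fin L) ℂ) * X) i = ∑ c, B i c • panel X c := by
  ext l k
  simp [panel, Matrix.mul_apply, Fintype.sum_prod_type, Matrix.sum_apply, Matrix.one_apply]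

/-- A left annihilator with invertible blocks gives WAX decompositions with an arbitrary invertible
block at a prescribed panel. -/
theorem exists_isWAX_of_annihilator {τ ρ κ : Type*} [Fintype τ] [DecidableEq τ] [Fintype ρ]
    [DecidableEq ρ] {L : ℕ} (AB : Matrix ρ τ ℂ) (H : Matrix ((τ ⊕ ρ) × Fin L) κ ℂ)
    (U : Matrix (Fin L) ((τ ⊕ ρ) × Fin L) ℂ) (hU : U * constraintMatrix AB H = 0)
    (hdet : ∀ i, (U.submatrix id (Prod.mk i)).det ≠ 0) (i₀ : τ ⊕ ρ)
    (W₁ : Matrix (Fin L) (Fin L) ℂ) (hW₁ : IsUnit W₁) :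
    ∃ W X, W i₀ = W₁ ∧
      IsWAX (Matrix.fromRows 1 AB ⊗ₖ (1 : Matrix (Fin L) (Fin L) ℂ)) H W X := by
  rw [constraint_iff] at hU
  let V : τ ⊕ ρ → Matrix (Fin L) (Fin L) ℂ := fun i => U.submatrix id (Prod.mk i)
  have hunit : ∀ i, IsUnit (V i).det := fun i => isUnit_iff_ne_zero.mpr (hdet i)
  have hW₁' : IsUnit W₁.det := (Matrix.isUnit_iff_isUnit_det _).mp hW₁
  -- The equations are invariant under a common left factor `G` on all `V i`; this choice makes `(G
  -- * V i₀)⁻¹ = W₁`.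
  let G : Matrix (Fin L) (Fin L) ℂ := W₁⁻¹ * (V i₀)⁻¹
  let X : Matrix (τ × Fin L) κ ℂ :=
    Matrix.of fun cl k => (G * (V (Sum.inl cl.1) * panel H (Sum.inl cl.1))) cl.2 k
  have hX : ∀ c, panel X c = G * (V (Sum.inl c) * panel H (Sum.inl c)) := fun c => rfl
  have hWG : ∀ (i : τ ⊕ ρ) (Y : Matrix (Fin L) κ ℂ),
      ((V i)⁻¹ * V i₀ * W₁) * (G * (V i * Y)) = Y := by
    intro i Y
    calc ((V i)⁻¹ * V i₀ * W₁) * (G * (V i * Y))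
        = (V i)⁻¹ * (V i₀ * ((W₁ * W₁⁻¹) * ((V i₀)⁻¹ * (V i * Y)))) := by
          simp only [G, Matrix.mul_assoc]
      _ = Y := by
          rw [Matrix.mul_nonsing_inv _ hW₁', Matrix.one_mul,
            Matrix.mul_nonsing_inv_cancel_left _ _ (hunit i₀),
            Matrix.nonsing_inv_mul_cancel_left _ _ (hunit i)]
  refine ⟨fun i => (V i)⁻¹ * V i₀ * W₁, X, ?_, ?_⟩
  · dsimp only
    rw [Matrix.nonsing_inv_mul _ (hunit i₀), Matrix.one_mul]
  · have hpanel : ∀ i, panel (Matrix.fromRows 1 AB ⊗ₖ (1 : Matrix (Fin L) (Fin L) ℂ) * X) i =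
        G * (V i * panel H i) := by
      rintro (c | r)
      · rw [kronecker_one_mul_panel]
        simp [Matrix.one_apply, hX]
      · rw [kronecker_one_mul_panel, show V (Sum.inr r) * panel H (Sum.inr r) = _ from hU r,
          Matrix.mul_sum]
        refine Finset.sum_congr rfl fun c _ => ?_
        rw [hX, Matrix.fromRows_apply_inr, Matrix.mul_smul]
    rw [IsWAX, Matrix.mul_assoc]
    ext ⟨i, l⟩ k
    rw [diagW_mul_apply, hpanel, hWG]
    rfl

-- Turns column independence into separate conditions: each panel of `H` must kill one combination
-- of the vectors `x (r, ·)`.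
open Matrix in
theorem constraintMatrix_mulVec {τ ρ κ : Type*} [Fintype ρ] [DecidableEq ρ] [Fintype κ] {L : ℕ}
    (AB : Matrix ρ τ ℂ) (H : Matrix ((τ ⊕ ρ) × Fin L) κ ℂ) (x : ρ × κ → ℂ) (i : τ ⊕ ρ)
    (l : Fin L) :
    (constraintMatrix AB H *ᵥ x) (i, l) =
      (panel H i *ᵥ ∑ r, Matrix.fromCols (-AB) 1 r i • fun k => x (r, k)) l := by
  simp only [Matrix.mulVec, dotProduct, constraintMatrix, Matrix.of_apply, Fintype.sum_prod_type,
    panel, Matrix.submatrix_apply, id, Finset.sum_apply, Pi.smul_apply, smul_eq_mul,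
    Finset.mul_sum]
  rw [Finset.sum_comm]
  refine Finset.sum_congr rfl fun k _ => Finset.sum_congr rfl fun r _ => ?_
  ring

open Matrix in
/-- If `H = A X` for some `X` such that the columns of the constraint matrix of `H` are linearly
independent, then random matrices admit WAX decompositions. -/
theorem ae_exists_isWAX {Ω τ ρ κ : Type*} [MeasurableSpace Ω] (P : Measure Ω) [Fintype τ]
    [DecidableEq τ] [Fintype ρ] [DecidableEq ρ] [Fintype κ] [DecidableEq κ] {L : ℕ}
    (AB : Matrix ρ τ ℂ) (H₀ : Matrix ((τ ⊕ ρ) × Fin L) κ ℂ)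
    (hH₀ : ∀ r, panel H₀ (Sum.inr r) = ∑ c, AB r c • panel H₀ (Sum.inl c))
    (hinj : ∀ x : ρ × κ → ℂ, constraintMatrix AB H₀ *ᵥ x = 0 → x = 0)
    (H : Ω → Matrix ((τ ⊕ ρ) × Fin L) κ ℂ) (hH : RandomlyChosen P H) (i₀ : τ ⊕ ρ) :
    ∀ᵐ ω ∂P, ∀ W₁ : Matrix (Fin L) (Fin L) ℂ, IsUnit W₁ →
      ∃ W X, W i₀ = W₁ ∧
        IsWAX (Matrix.fromRows 1 AB ⊗ₖ (1 : Matrix (Fin L) (Fin L) ℂ)) (H ω) W X := by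
  let S : Matrix ((τ ⊕ ρ) × Fin L) (ρ × κ) (MvPolynomial (((τ ⊕ ρ) × Fin L) × κ) ℂ) :=
    constraintMatrix (AB.map MvPolynomial.C) (Matrix.of fun i k => MvPolynomial.X (i, k))
  have hS : ∀ h : ((τ ⊕ ρ) × Fin L) × κ → ℂ, S.map (MvPolynomial.eval h) =
      constraintMatrix AB (Matrix.of fun i k => h (i, k)) := by
    intro h
    ext ⟨i | i, l⟩ ⟨r, k⟩
    · simp [S, constraintMatrix]
    · simp [S, constraintMatrix, Matrix.one_apply, apply_ite (MvPolynomial.eval h)]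
  let U₀ : Matrix (Fin L) ((τ ⊕ ρ) × Fin L) ℂ := Matrix.of fun a pl => (1 : Matrix _ _ ℂ) a pl.2
  have hU₀ : ∀ i, U₀.submatrix id (Prod.mk i) = 1 := fun i => rfl
  have hH₀' : S.map (MvPolynomial.eval fun ij => H₀ ij.1 ij.2) = constraintMatrix AB H₀ := hS _
  obtain ⟨f, hf, hfU⟩ := exists_poly_annihilator S (fun ij => H₀ ij.1 ij.2)
    (by rw [hH₀']; exact hinj) U₀
    (by
      rw [hH₀', constraint_iff]
      intro r
      simp only [hU₀, Matrix.one_mul, hH₀ r])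
    (by intro i; rw [hU₀, Matrix.det_one]; exact one_ne_zero)
  filter_upwards [hH.2 f hf] with ω hω W₁ hW₁
  obtain ⟨U, hU, hdet⟩ := hfU _ hω
  rw [hS] at hU
  exact exists_isWAX_of_annihilator AB (H ω) U hU hdet i₀ W₁ hW₁

/-! ### The witness built from coordinate projections -/

-- The rows of `B` are the coordinate functionals of `S`, placed by an injection of `S` into `ι`;
-- the other rows are zero.
open Matrix in
theorem exists_matrix_mulVec_eq_zero_imp {ι κ : Type*} [Fintype ι] [Fintype κ] [DecidableEq κ]
    (S : Finset κ) (hS : S.card ≤ Fintype.card ι) :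
    ∃ B : Matrix ι κ ℂ, ∀ x : κ → ℂ, B *ᵥ x = 0 → ∀ i ∈ S, x i = 0 := by
  classical
  obtain ⟨g⟩ : Nonempty (S ↪ ι) :=
    Function.Embedding.nonempty_of_card_le (by simpa using hS)
  refine ⟨Matrix.of fun a i => if ∃ h : i ∈ S, g ⟨i, h⟩ = a then 1 else 0, fun x hx i hi => ?_⟩
  have h1 := congrFun hx (g ⟨i, hi⟩)
  simp only [Matrix.mulVec, dotProduct, Matrix.of_apply, Pi.zero_apply] at h1
  rw [Finset.sum_eq_single_of_mem i (Finset.mem_univ i)] at h1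
  · rw [if_pos ⟨hi, rfl⟩, one_mul] at h1
    exact h1
  · intro b _ hb
    rw [if_neg, zero_mul]
    rintro ⟨h, h2⟩
    exact hb (congrArg Subtype.val (g.injective h2))

/-- The bound on `L` in integer form. -/
theorem numeric_bound {MP TP L K : ℕ}
    (hL : (L : ℝ) ≥ (K : ℝ) / (1 + (Q1 MP TP : ℝ) + invQ2 MP TP)) :
    (J MP TP = 0 → K ≤ (1 + Q1 MP TP) * L) ∧
      (J MP TP ≠ 0 → ∀ r < Phi MP TP,
        (r / J MP TP + 1) * (K - (1 + Q1 MP TP) * L) ≤ L) := by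
  have hinv : 0 ≤ invQ2 MP TP := by
    unfold invQ2
    split_ifs <;> positivity
  rw [ge_iff_le, div_le_iff₀ (by positivity)] at hL
  constructor
  · intro hJ
    rw [invQ2, if_pos hJ, add_zero] at hL
    rw [mul_comm]
    exact_mod_cast hL
  · intro hJ r hr
    rw [invQ2, if_neg hJ] at hL
    have hJ' : (0 : ℝ) < J MP TP := by exact_mod_cast Nat.pos_of_ne_zero hJ
    have hQ : (Phi MP TP : ℝ) ≤ Q2 MP TP * J MP TP := by
      rw [← div_le_iff₀ hJ']
      exact Nat.le_ceil _
    have hQ' : Phi MP TP ≤ Q2 MP TP * J MP TP := by exact_mod_cast hQ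
    have hs : r / J MP TP < Q2 MP TP :=
      (Nat.div_lt_iff_lt_mul (Nat.pos_of_ne_zero hJ)).mpr (hr.trans_le hQ')
    have hQpos : (0 : ℝ) < Q2 MP TP := by exact_mod_cast (Nat.zero_le _).trans_lt hs
    -- The hypothesis multiplied by `Q2`: with `d = K - (1 + Q1) L`, truncated at `0`, it says `Q2 *
    -- d ≤ L`.
    have h1 : (K : ℝ) * Q2 MP TP ≤ (1 + Q1 MP TP) * L * Q2 MP TP + L := by
      calc (K : ℝ) * Q2 MP TP ≤ (L * (1 + Q1 MP TP + 1 / Q2 MP TP)) * Q2 MP TP := by gcongr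
        _ = _ := by field_simp
    have h2 : K * Q2 MP TP ≤ (1 + Q1 MP TP) * L * Q2 MP TP + L := by exact_mod_cast h1
    calc (r / J MP TP + 1) * (K - (1 + Q1 MP TP) * L)
        ≤ Q2 MP TP * (K - (1 + Q1 MP TP) * L) := Nat.mul_le_mul_right _ hs
      _ = K * Q2 MP TP - (1 + Q1 MP TP) * L * Q2 MP TP := by
          rw [mul_comm, Nat.sub_mul]
      _ ≤ L := by omega

open Matrix in
/-- A matrix `A X` whose constraint matrix has linearly independent columns. -/
theorem exists_injective_witness (MP TP L K : ℕ) (hQ1 : 1 ≤ Q1 MP TP)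
    (hL : (L : ℝ) ≥ (K : ℝ) / (1 + (Q1 MP TP : ℝ) + invQ2 MP TP)) :
    ∃ H₀ : Matrix (Panel MP TP × Fin L) (Fin K) ℂ,
      (∀ r, panel H₀ (Sum.inr r) = ∑ c, AtildeB MP TP r c • panel H₀ (Sum.inl c)) ∧
      ∀ x : Fin (Phi MP TP) × Fin K → ℂ,
        constraintMatrix (AtildeB MP TP) H₀ *ᵥ x = 0 → x = 0 := by
  obtain ⟨hb0, hb1⟩ := numeric_bound hL
  set d := K - (1 + Q1 MP TP) * L with hd
  have hLQ : L ≤ Q1 MP TP * L := Nat.le_mul_of_pos_left L hQ1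
  have hexp : (1 + Q1 MP TP) * L = L + Q1 MP TP * L := by ring
  -- Consecutive disjoint windows of length `d` starting at `L`: the coordinates that `Z` and `B r`
  -- leave free for row `r`, with `s = r / J`. By `(s + 1) * d ≤ L` they lie in `[L, 2L)`, where `Y`
  -- acts.
  let D : ℕ → Finset (Fin K) := fun s =>
    Finset.univ.filter fun i => L + s * d ≤ (i : ℕ) ∧ (i : ℕ) < L + (s + 1) * d
  have hcard : ∀ (p : ℕ → Prop) [DecidablePred p],
      (Finset.univ.filter fun i : Fin K => p i).card = ((Finset.range K).filter p).card := by
    intro p _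
    rw [← Finset.card_map Fin.valEmbedding]
    congr 1
    ext a
    simp only [Finset.mem_map, Finset.mem_filter, Finset.mem_univ, true_and,
      Fin.valEmbedding_apply, Finset.mem_range]
    exact ⟨fun ⟨i, hi, h⟩ => h ▸ ⟨i.2, hi⟩, fun ⟨h1, h2⟩ => ⟨⟨a, h1⟩, h2, rfl⟩⟩
  obtain ⟨Z, hZ⟩ := exists_matrix_mulVec_eq_zero_imp (ι := Fin L)
    (Finset.univ.filter fun i : Fin K => (i : ℕ) < L) (by
      rw [hcard fun i => i < L, Fintype.card_fin]
      refine (Finset.card_le_card (t := Finset.range L) ?_).trans (by simp)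
      intro a ha
      simp only [Finset.mem_filter, Finset.mem_range] at ha ⊢
      exact ha.2)
  obtain ⟨Y, hY⟩ := exists_matrix_mulVec_eq_zero_imp (ι := Fin L)
    (Finset.univ.filter fun i : Fin K => L ≤ (i : ℕ) ∧ (i : ℕ) < L + L) (by
      rw [hcard fun i => L ≤ i ∧ i < L + L, Fintype.card_fin]
      refine (Finset.card_le_card (t := Finset.Ico L (L + L)) ?_).trans (by simp)
      intro a ha
      simp only [Finset.mem_filter, Finset.mem_Ico] at ha ⊢
      exact ha.2)
  have hB : ∀ r : Fin (Phi MP TP), ∃ B : Matrix (Fin (Q1 MP TP) × Fin L) (Fin K) ℂ,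
      ∀ x : Fin K → ℂ, B *ᵥ x = 0 →
        ∀ i : Fin K, L ≤ (i : ℕ) → i ∉ D (r / J MP TP) → x i = 0 := by
    intro r
    set s := (r : ℕ) / J MP TP with hs
    obtain ⟨B, hB⟩ := exists_matrix_mulVec_eq_zero_imp (ι := Fin (Q1 MP TP) × Fin L)
      (Finset.univ.filter fun i : Fin K => L ≤ (i : ℕ) ∧
        ¬ (L + s * d ≤ (i : ℕ) ∧ (i : ℕ) < L + (s + 1) * d)) (by
        rw [hcard fun i => L ≤ i ∧ ¬ (L + s * d ≤ i ∧ i < L + (s + 1) * d), Fintype.card_prod,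
          Fintype.card_fin, Fintype.card_fin]
        -- For `d > 0` the window lies inside `[L, K)` because `2L ≤ (1 + Q1) L ≤ K`, so exactly `K
        -- - L - d = Q1 * L` coordinates remain.
        rcases Nat.eq_zero_or_pos d with h0 | h0
        · refine (Finset.card_le_card (t := Finset.Ico L K) ?_).trans ?_
          · intro a ha
            simp only [Finset.mem_filter, Finset.mem_range, Finset.mem_Ico] at ha ⊢
            omega
          · rw [Nat.card_Ico]
            omega
        · have hJ : J MP TP ≠ 0 := by
            intro hJ
            have := hb0 hJ
            omega
          have hsd := hb1 hJ r r.2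
          rw [← hs] at hsd
          have hsd' : (s + 1) * d = s * d + d := by ring
          refine (Finset.card_le_card
            (t := Finset.Ico L K \ Finset.Ico (L + s * d) (L + (s + 1) * d)) ?_).trans ?_
          · intro a ha
            simp only [Finset.mem_filter, Finset.mem_range, Finset.mem_Ico,
              Finset.mem_sdiff] at ha ⊢
            exact ⟨⟨ha.2.1, ha.1⟩, ha.2.2⟩
          · rw [Finset.card_sdiff_of_subset, Nat.card_Ico, Nat.card_Ico]
            · omega
            · intro a ha
              simp only [Finset.mem_Ico] at ha ⊢
              omega)
    refine ⟨B, fun x hx i hi hiD => hB x hx i ?_⟩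
    simp only [Finset.mem_filter, Finset.mem_univ, true_and, D] at hiD ⊢
    exact ⟨hi, hiD⟩
  choose B hB using hB
  -- Each bottom row picks up exactly one `Y` from the cropped block when `J ≠ 0`; the `-Y` in the
  -- first column cancels it, leaving `Z + ∑ q, panel (B r) q`.
  let X : Col MP TP → Matrix (Fin L) (Fin K) ℂ := Sum.elim
    (fun _ => if J MP TP = 0 then Z else Z - Y)
    (Sum.elim (fun _ => Y) fun qr => panel (B qr.2) qr.1)
  let H₀ : Matrix (Panel MP TP × Fin L) (Fin K) ℂ := Matrix.of fun il =>
    Sum.elim X (fun r => ∑ c, AtildeB MP TP r c • X c) il.1 il.2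
  have hpl : ∀ c, panel H₀ (Sum.inl c) = X c := fun c => rfl
  have hpr : ∀ r, panel H₀ (Sum.inr r) = ∑ c, AtildeB MP TP r c • X c := fun r => rfl
  have hprZ : ∀ r, panel H₀ (Sum.inr r) = Z + ∑ q, panel (B r) q := by
    intro r
    rw [hpr]
    simp only [AtildeB, Fintype.sum_sum_type, Matrix.fromCols_apply_inl,
      Matrix.fromCols_apply_inr, Matrix.of_apply, X, Sum.elim_inl, Sum.elim_inr,
      Fintype.sum_prod_type, Matrix.one_apply, ite_smul, one_smul, zero_smul, cropped,
      Finset.sum_ite_eq, Finset.mem_univ, if_true, Finset.univ_unique, Finset.sum_singleton]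
    rw [← add_assoc]
    congr 1
    by_cases hJ : J MP TP = 0
    · rw [if_pos hJ]
      have : IsEmpty (Fin (J MP TP)) := by rw [hJ]; infer_instance
      simp
    · rw [if_neg hJ, Finset.sum_eq_single_of_mem
        (⟨r % J MP TP, Nat.mod_lt _ (Nat.pos_of_ne_zero hJ)⟩ : Fin (J MP TP)) (Finset.mem_univ _)]
      · simp
      · intro b _ hb
        rw [if_neg]
        intro h
        exact hb (Fin.ext h.symm)
  refine ⟨H₀, fun r => rfl, fun x hx => ?_⟩
  let y : Fin (Phi MP TP) → Fin K → ℂ := fun r k => x (r, k)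
  have hpanel : ∀ i, panel H₀ i *ᵥ
      ∑ r, Matrix.fromCols (-AtildeB MP TP) 1 r i • y r = 0 := by
    intro i
    ext l
    rw [← constraintMatrix_mulVec, hx]
    rfl
  have hbot : ∀ r, panel H₀ (Sum.inr r) *ᵥ y r = 0 := by
    intro r
    simpa [Matrix.one_apply] using hpanel (Sum.inr r)
  have hq : ∀ r q, panel (B r) q *ᵥ y r = 0 := by
    intro r q
    have h := hpanel (Sum.inl (Sum.inr (Sum.inr (q, r))))
    simpa [hpl, X, AtildeB, Matrix.one_apply, Matrix.mulVec_neg] using h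
  have hj : ∀ j : Fin (J MP TP), Y *ᵥ
      ∑ r : Fin (Phi MP TP), (if (r : ℕ) % J MP TP = j then y r else 0) = 0 := by
    intro j
    have h := hpanel (Sum.inl (Sum.inr (Sum.inl j)))
    simpa [hpl, X, AtildeB, cropped, Matrix.mulVec_neg] using h
  have hBy : ∀ r : Fin (Phi MP TP), ∀ i : Fin K, L ≤ (i : ℕ) → i ∉ D (r / J MP TP) → y r i = 0 := by
    intro r
    apply hB r
    ext ⟨q, l⟩
    exact congrFun (hq r q) l
  have hZy : ∀ r : Fin (Phi MP TP), ∀ i : Fin K, (i : ℕ) < L → y r i = 0 := by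
    intro r i hi
    refine hZ (y r) ?_ i (by simpa using hi)
    have h := hbot r
    rw [hprZ, Matrix.add_mulVec, Matrix.sum_mulVec] at h
    simpa [hq] using h
  have hoff : ∀ r : Fin (Phi MP TP), ∀ i : Fin K, i ∉ D (r / J MP TP) → y r i = 0 := by
    intro r i hi
    rcases lt_or_ge (i : ℕ) L with h | h
    · exact hZy r i h
    · exact hBy r i h hi
  ext ⟨r, i⟩
  change y r i = 0
  by_contra hne
  have hi : i ∈ D (r / J MP TP) := by
    by_contra h
    exact hne (hoff r i h)
  have hi' := hi
  simp only [D, Finset.mem_filter, Finset.mem_univ, true_and] at hi'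
  have hJ : J MP TP ≠ 0 := by
    intro hJ
    have := hb0 hJ
    have h0 : d = 0 := by omega
    rw [h0] at hi'
    omega
  have hsd := hb1 hJ r r.2
  -- `Y` sees only the sum of the `y b` with `b ≡ r mod J`. These rows have distinct quotients `b /
  -- J`, hence disjoint windows, so at `i` only `y r` contributes.
  have hsum := hY _ (hj ⟨r % J MP TP, Nat.mod_lt _ (Nat.pos_of_ne_zero hJ)⟩) i (by
    simp only [Finset.mem_filter, Finset.mem_univ, true_and]
    have : L ≤ L + (r : ℕ) / J MP TP * d := Nat.le_add_right _ _
    omega)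
  rw [Finset.sum_apply, Finset.sum_eq_single_of_mem r (Finset.mem_univ r)] at hsum
  · simp only [if_true] at hsum
    exact hne hsum
  · intro b _ hbr
    split_ifs with hmod
    · refine hoff b i fun hib => hbr ?_
      simp only [D, Finset.mem_filter, Finset.mem_univ, true_and] at hib
      have hdiv : (b : ℕ) / J MP TP = (r : ℕ) / J MP TP := by
        rcases lt_trichotomy ((b : ℕ) / J MP TP) ((r : ℕ) / J MP TP) with h | h | h
        · have := Nat.mul_le_mul_right d (Nat.succ_le_of_lt h)
          simp only [Nat.succ_eq_add_one] at this
          omega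
        · exact h
        · have := Nat.mul_le_mul_right d (Nat.succ_le_of_lt h)
          simp only [Nat.succ_eq_add_one] at this
          omega
      apply Fin.ext
      rw [← Nat.div_add_mod (b : ℕ) (J MP TP), hdiv, hmod, Nat.div_add_mod]
    · rfl

end WAX

theorem proposition5 (MP TP L K : ℕ) (hQ1 : 1 ≤ WAX.Q1 MP TP)
    (hL : (L : ℝ) ≥ (K : ℝ) / (1 + (WAX.Q1 MP TP : ℝ) + WAX.invQ2 MP TP))
    {Ω : Type*} [MeasurableSpace Ω] (P : Measure Ω) [IsProbabilityMeasure P]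
    (H : Ω → Matrix (WAX.Panel MP TP × Fin L) (Fin K) ℂ) (hH : WAX.RandomlyChosen P H) :
    ∀ᵐ ω ∂P,
      WAX.AdmitsWAX (WAX.A MP TP L) (H ω) ∧
      ∀ W₁ : Matrix (Fin L) (Fin L) ℂ, IsUnit W₁ →
        ∃ W X, W (WAX.firstPanel MP TP) = W₁ ∧ WAX.IsWAX (WAX.A MP TP L) (H ω) W X := by
  obtain ⟨H₀, hH₀, hinj⟩ := WAX.exists_injective_witness MP TP L K hQ1 hL
  filter_upwards [WAX.ae_exists_isWAX P (WAX.AtildeB MP TP) H₀ hH₀ hinj H hH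
    (WAX.firstPanel MP TP)] with ω hω
  obtain ⟨W, X, -, hWX⟩ := hω 1 isUnit_one
  exact ⟨⟨W, X, hWX⟩, hω⟩
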